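/- Let $a,b\ge 0$ with $a+b>0$, let $c>0$ and $\Delta t>0$, and consider the linear test system $\mathbf y'=\mathbf\Lambda\mathbf y$ on $\mathbb R^2_{>0}$ with $$\mathbf\Lambda=\mathbf S^+-\mathbf S^-=\begin{pmatrix}-ac & bc\\ a & -b\end{pmatrix},\qquad \mathbf S^+=\begin{pmatrix}0&bc\\a&0\end{pmatrix},\qquad \mathbf S^-=\begin{pmatrix}ac&0\\0&b\end{pmatrix}.$$ Let $\varphi(0)=1$ and $\varphi(x)=(1-e^{-x})/x$ for $x>0$. The GeCo2 scheme with step size $\Delta t$, applied to this system, is the iteration $\mathbf y^{n+1}=\mathbf g(\mathbf y^n)$, $\mathbf y^0\in\mathbb R^2_{>0}$, where for $\mathbf y\in\mathbb R^2_{>0}$ $$\mathbf y^{(2)}=\mathbf y+\Delta t\,\varphi\Big(\Delta t\sum_{i=1}^2\frac{(\mathbf S^-\mathbf y)_i}{y_i}\Big)\mathbf\Lambda\mathbf y,\qquad \mathbf w(\mathbf y)=2\varphi\Big(\Delta t\sum_{i=1}^2\frac{(\mathbf S^-\mathbf y)_i}{y_i}\Big)\mathbf\Lambda\mathbf y-\mathbf\Lambda\mathbf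 y-\mathbf\Lambda\mathbf y^{(2)},$$ $$\mathbf g(\mathbf y)=\mathbf y+\frac{\Delta t}{2}\,\varphi\Big(\Delta t\sum_{i=1}^2\frac{\max(0,w_i(\mathbf y))}{y_i}\Big)\,\mathbf\Lambda\big(\mathbf y+\mathbf y^{(2)}\big).$$ A fixed point $\mathbf y^*$ of $\mathbf g$ is called stable if for every $\varepsilon>0$ there is $\delta>0$ such that $\mathbf y^0\in\mathbb R^2_{>0}$ and $\|\mathbf y^0-\mathbf y^*\|<\delta$ imply $\|\mathbf y^n-\mathbf y^*\|<\varepsilon$ for all $n\ge0$, and unstable if it is not stable. Let $\mathbf y^*\in\mathbb R^2_{>0}$ be a steady state, i.e. $\mathbf\Lambda\mathbf y^*=\mathbf 0$. Then: 1. There is an open neighborhood $\mathcal D\subseteq\mathbb R^2_{>0}$ of $\mathbf y^*$ on which $\mathbf g$ is $\mathcal C^1$ with Lipschitz continuous first derivatives. The stability function is $$R(z)=1+z+\tfrac12 z^2\varphi(\Delta t\,\operatorname{tr}\mathbf S^-),$$ that is, the Jacobian of $\mathbf g$ at $\mathbf y^*$ is $R(\Delta t\,\mathbf\Lambda)$;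 its eigenvalues, with multiplicity, are $1$ and $R(-\Delta t(ac+b))$. If $|R(-\Delta t(ac+b))|<1$, then $\mathbf y^*$ is a stable fixed point of $\mathbf g$, and there exists $\delta>0$ such that for every $\mathbf y^0\in\mathbb R^2_{>0}$ with $y^0_1+c\,y^0_2=y^*_1+c\,y^*_2$ and $\|\mathbf y^0-\mathbf y^*\|<\delta$ one has $\lim_{n\to\infty}\mathbf y^n=\mathbf y^*$. If $|R(-\Delta t(ac+b))|>1$, then $\mathbf y^*$ is an unstable fixed point of $\mathbf g$. 2. The map $\mathbf g$ is not $\mathcal C^2$ on any neighborhood of $\mathbf y^*$. -/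

import Mathlib

open Filter Topology
open scoped Matrix NNReal

noncomputable section

/-- The step size modification function: `φ 0 = 1` and `φ x = (1 - e⁻ˣ) / x` for `x ≠ 0`
(it is only ever evaluated at `x ≥ 0` when the scheme acts on positive vectors). -/
def gecoPhi (x : ℝ) : ℝ := if x = 0 then 1 else (1 - Real.exp (-x)) / x

section Scheme

variable {ι : Type*} [Fintype ι]

/-- The first-stage weight `φ(Δt ∑ᵢ fᵢᴰ(y) / yᵢ)`. -/
def gecoWeight (fD : (ι → ℝ) → ι → ℝ) (Δt : ℝ) (y : ι → ℝ) : ℝ :=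
  gecoPhi (Δt * ∑ i, fD y i / y i)

/-- The second stage `y⁽²⁾ = y + Δt φ(Δt ∑ᵢ fᵢᴰ(y) / yᵢ) f(y)`, where `f = fᴾ - fᴰ`. -/
def geco2Stage (fP fD : (ι → ℝ) → ι → ℝ) (Δt : ℝ) (y : ι → ℝ) : ι → ℝ :=
  y + (Δt * gecoWeight fD Δt y) • (fP y - fD y)

/-- `w(y) = 2 φ(Δt ∑ᵢ fᵢᴰ(y) / yᵢ) f(y) - f(y) - f(y⁽²⁾)`. -/
def geco2W (fP fD : (ι → ℝ) → ι → ℝ) (Δt : ℝ) (y : ι → ℝ) : ι → ℝ :=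
  (2 * gecoWeight fD Δt y) • (fP y - fD y) - (fP y - fD y)
    - (fP (geco2Stage fP fD Δt y) - fD (geco2Stage fP fD Δt y))

/-- One step `yⁿ ↦ yⁿ⁺¹` of the second order GeCo scheme with step size `Δt` for the autonomous
production-destruction system `y' = f(y) = fᴾ(y) - fᴰ(y)`:
`yⁿ⁺¹ = yⁿ + (Δt / 2) φ(Δt ∑ᵢ max(0, wᵢ(yⁿ)) / yᵢⁿ) (f(yⁿ) + f(y⁽²⁾))`. -/
def geco2Step (fP fD : (ι → ℝ) → ι → ℝ) (Δt : ℝ) (y : ι → ℝ) : ι → ℝ :=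
  y + (Δt / 2 * gecoPhi (Δt * ∑ i, max 0 (geco2W fP fD Δt y i) / y i)) •
    ((fP y - fD y) + (fP (geco2Stage fP fD Δt y) - fD (geco2Stage fP fD Δt y)))

/-- The set of (componentwise) positive vectors. -/
def posVectors (ι : Type*) : Set (ι → ℝ) := {y | ∀ i, 0 < y i}

/-- `y` is a Lyapunov stable fixed point of the iteration `yⁿ⁺¹ = g(yⁿ)` on `D`. -/
def IsLyapunovStable (g : (ι → ℝ) → ι → ℝ) (D : Set (ι → ℝ)) (y : ι → ℝ) : Prop :=
  g y = y ∧ ∀ ε > 0, ∃ δ > 0, ∀ y₀ ∈ D, ‖y₀ - y‖ < δ → ∀ n : ℕ, ‖g^[n] y₀ - y‖ < ε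

/-- `y` is an unstable fixed point of the iteration: a fixed point that is not Lyapunov stable. -/
def IsUnstable (g : (ι → ℝ) → ι → ℝ) (D : Set (ι → ℝ)) (y : ι → ℝ) : Prop :=
  g y = y ∧ ¬ IsLyapunovStable g D y

/-- `R` is the stability function, at the steady state `y` of `y' = Λ y`, of the one-step method
generated by `g` with step size `Δt`: the Jacobian of `g` at `y` is `R(Δt Λ)`. -/
def IsStabilityFunctionAt [DecidableEq ι] (R : Polynomial ℝ) (g : (ι → ℝ) → ι → ℝ)
    (Λ : Matrix ι ι ℝ) (Δt : ℝ) (y : ι → ℝ) : Prop :=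
  HasFDerivAt g (Matrix.toLin' (Polynomial.aeval (Δt • Λ) R)).toContinuousLinearMap y

end Scheme

/-- The production matrix of the test system. -/
def testSPlus (a b c : ℝ) : Matrix (Fin 2) (Fin 2) ℝ := !![0, b * c; a, 0]

/-- The destruction matrix of the test system. -/
def testSMinus (a b c : ℝ) : Matrix (Fin 2) (Fin 2) ℝ := !![a * c, 0; 0, b]

/-- The system matrix `Λ = S⁺ - S⁻` of the test system `y' = Λ y`. -/
def testLambda (a b c : ℝ) : Matrix (Fin 2) (Fin 2) ℝ := testSPlus a b c - testSMinus a b c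

/-- The map generating the GeCo2 iterates for the test system `y' = S⁺ y - S⁻ y`. -/
def geco2Map (a b c Δt : ℝ) : (Fin 2 → ℝ) → Fin 2 → ℝ :=
  geco2Step (fun y => testSPlus a b c *ᵥ y) (fun y => testSMinus a b c *ᵥ y) Δt

/-- The polynomial `R(z) = 1 + z + ½ z² φ(Δt tr S⁻)`. -/
def geco2R (a b c Δt : ℝ) : Polynomial ℝ :=
  1 + Polynomial.X
    + Polynomial.C (1 / 2 * gecoPhi (Δt * (testSMinus a b c).trace)) * Polynomial.X ^ 2

end

/-!
The system matrix has rank one, `Λ = v lᵀ`, and `f(y) = (l ⬝ᵥ y) v`. With `T = Δt tr S⁻`, the second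
stage multiplies `l ⬝ᵥ y` by `1 - T φ(T) = e⁻ᵀ`, so that `g(y) = y + ω(y) (l ⬝ᵥ y) v` for a scalar
weight `ω`. Steps along `v` conserve `(l ⬝ᵥ v) y - (l ⬝ᵥ y) v`, and `l ⬝ᵥ y` is multiplied by
`1 + ω(y) (l ⬝ᵥ v)`, which at the steady state is `R(-T)`; this scalar recursion decides stability.

Since `w(y) = -κ (l ⬝ᵥ y) v` with `κ = 1 + e⁻ᵀ - 2 φ(T) > 0`, the maxima in `ω` switch on the
hyperplane `l ⬝ᵥ y = 0` of steady states and `ω` is smooth on either side of it. The factor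
`l ⬝ᵥ y` vanishes there and gains one derivative, so `g` is `C¹` with Lipschitz derivative. A second
derivative of `t ω(y* + t v)` at `t = 0` would force the one-sided derivatives of `ω` to agree, but
they differ by a nonzero multiple of `∑ᵢ |vᵢ| / y*ᵢ`.
-/

section ClosedCover

variable {E F X : Type*} {s A B : Set E}

theorem lipschitzOnWith_of_closed_cover [SeminormedAddCommGroup E] [NormedSpace ℝ E]
    [PseudoMetricSpace X] {f : E → X} {K : ℝ≥0} (hs : Convex ℝ s) (hA : IsClosed A)
    (hB : IsClosed B) (hAB : s ⊆ A ∪ B) (hfA : LipschitzOnWith K f (s ∩ A))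
    (hfB : LipschitzOnWith K f (s ∩ B)) : LipschitzOnWith K f s := by
  have hcross : ∀ x ∈ s ∩ A, ∀ y ∈ s ∩ B, dist (f x) (f y) ≤ K * dist x y := by
    rintro x ⟨hxs, hxA⟩ y ⟨hys, hyB⟩
    have hseg : segment ℝ x y ⊆ s := hs.segment_subset hxs hys
    obtain ⟨z, hz, hzA, hzB⟩ := isPreconnected_closed_iff.1 (convex_segment x y).isPreconnected
      A B hA hB (hseg.trans hAB) ⟨x, left_mem_segment ℝ x y, hxA⟩ ⟨y, right_mem_segment ℝ x y, hyB⟩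
    calc dist (f x) (f y) ≤ dist (f x) (f z) + dist (f z) (f y) := dist_triangle _ _ _
      _ ≤ K * dist x z + K * dist z y := add_le_add
        (hfA.dist_le_mul x ⟨hxs, hxA⟩ z ⟨hseg hz, hzA⟩)
        (hfB.dist_le_mul z ⟨hseg hz, hzB⟩ y ⟨hys, hyB⟩)
      _ = K * dist x y := by rw [← mul_add, dist_add_dist_of_mem_segment hz]
  refine LipschitzOnWith.of_dist_le_mul fun x hx y hy => ?_
  rcases hAB hx with hxA | hxB <;> rcases hAB hy with hyA | hyB
  · exact hfA.dist_le_mul x ⟨hx, hxA⟩ y ⟨hy, hyA⟩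
  · exact hcross x ⟨hx, hxA⟩ y ⟨hy, hyB⟩
  · rw [dist_comm, dist_comm x]
    exact hcross y ⟨hy, hyA⟩ x ⟨hx, hxB⟩
  · exact hfB.dist_le_mul x ⟨hx, hxB⟩ y ⟨hy, hyB⟩

variable [NormedAddCommGroup E] [NormedSpace ℝ E] [NormedAddCommGroup F] [NormedSpace ℝ F]
  {f f₁ f₂ : E → F}

theorem hasFDerivAt_of_closed_cover {f' : E →L[ℝ] F} {x : E} (hA : IsClosed A) (hB : IsClosed B)
    (hAB : A ∪ B ∈ 𝓝 x) (hfA : x ∈ A → HasFDerivWithinAt f f' A x)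
    (hfB : x ∈ B → HasFDerivWithinAt f f' B x) : HasFDerivAt f f' x := by
  have hwithin : ∀ {C : Set E}, IsClosed C → (x ∈ C → HasFDerivWithinAt f f' C x) →
      HasFDerivWithinAt f f' C x := fun {C} hC h => by
    by_cases hx : x ∈ C
    · exact h hx
    · exact .of_notMem_closure (by rwa [hC.closure_eq])
  exact ((hwithin hA hfA).union (hwithin hB hfB)).hasFDerivAt hAB

theorem hasFDerivAt_of_eqOn_closed_cover (hs : IsOpen s) (hA : IsClosed A) (hB : IsClosed B)
    (hAB : s ⊆ A ∪ B) (h₁ : Set.EqOn f f₁ (s ∩ A)) (h₂ : Set.EqOn f f₂ (s ∩ B))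
    (hf₁ : DifferentiableOn ℝ f₁ s) (hf₂ : DifferentiableOn ℝ f₂ s)
    (h₁₂ : ∀ x ∈ s, x ∈ A → x ∈ B → fderiv ℝ f₁ x = fderiv ℝ f₂ x) {x : E} (hx : x ∈ s ∩ A) :
    HasFDerivAt f (fderiv ℝ f₁ x) x := by
  have hsx : s ∈ 𝓝 x := hs.mem_nhds hx.1
  have hpiece : ∀ {C : Set E} {h : E → F}, Set.EqOn f h (s ∩ C) → DifferentiableOn ℝ h s →
      x ∈ C → HasFDerivWithinAt f (fderiv ℝ h x) C x := fun {C h} heq hh hxC =>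
    (hh.differentiableAt hsx).hasFDerivAt.hasFDerivWithinAt.congr_of_eventuallyEq
      (by filter_upwards [self_mem_nhdsWithin, mem_nhdsWithin_of_mem_nhds hsx] with y hyC hys
          exact heq ⟨hys, hyC⟩) (heq ⟨hx.1, hxC⟩)
  refine hasFDerivAt_of_closed_cover hA hB (mem_of_superset hsx hAB) (hpiece h₁ hf₁) fun hxB => ?_
  rw [h₁₂ x hx.1 hx.2 hxB]
  exact hpiece h₂ hf₂ hxB

theorem exists_contDiffOn_one_lipschitzOnWith_fderiv_of_closed_cover {x₀ : E} (hs : IsOpen s)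
    (hx₀ : x₀ ∈ s) (hA : IsClosed A) (hB : IsClosed B) (hAB : s ⊆ A ∪ B)
    (h₁ : Set.EqOn f f₁ (s ∩ A)) (h₂ : Set.EqOn f f₂ (s ∩ B))
    (hf₁ : ContDiffOn ℝ 2 f₁ s) (hf₂ : ContDiffOn ℝ 2 f₂ s)
    (h₁₂ : ∀ x ∈ s, x ∈ A → x ∈ B → fderiv ℝ f₁ x = fderiv ℝ f₂ x) :
    ∃ D ⊆ s, IsOpen D ∧ x₀ ∈ D ∧ ContDiffOn ℝ 1 f D ∧
      ∃ K : ℝ≥0, LipschitzOnWith K (fderiv ℝ f) D := by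
  have hsx₀ : s ∈ 𝓝 x₀ := hs.mem_nhds hx₀
  obtain ⟨K₁, t₁, ht₁, hK₁⟩ :=
    ((hf₁.contDiffAt hsx₀).fderiv_right (m := 1) (by norm_num)).exists_lipschitzOnWith
  obtain ⟨K₂, t₂, ht₂, hK₂⟩ :=
    ((hf₂.contDiffAt hsx₀).fderiv_right (m := 1) (by norm_num)).exists_lipschitzOnWith
  obtain ⟨r, hr, hball⟩ := Metric.mem_nhds_iff.1 (inter_mem hsx₀ (inter_mem ht₁ ht₂))
  have hDs : Metric.ball x₀ r ⊆ s := fun x hx => (hball hx).1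
  have hd₁ := hf₁.differentiableOn two_ne_zero
  have hd₂ := hf₂.differentiableOn two_ne_zero
  have hdA : ∀ x ∈ s ∩ A, HasFDerivAt f (fderiv ℝ f₁ x) x := fun x =>
    hasFDerivAt_of_eqOn_closed_cover hs hA hB hAB h₁ h₂ hd₁ hd₂ h₁₂
  have hdB : ∀ x ∈ s ∩ B, HasFDerivAt f (fderiv ℝ f₂ x) x := fun x =>
    hasFDerivAt_of_eqOn_closed_cover hs hB hA (Set.union_comm A B ▸ hAB) h₂ h₁ hd₂ hd₁
      fun y hy hyB hyA => (h₁₂ y hy hyA hyB).symm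
  have hdiff : DifferentiableOn ℝ f (Metric.ball x₀ r) := fun x hx =>
    ((hAB (hDs hx)).elim (fun hxA => (hdA x ⟨hDs hx, hxA⟩).differentiableAt)
      fun hxB => (hdB x ⟨hDs hx, hxB⟩).differentiableAt).differentiableWithinAt
  have hlip : LipschitzOnWith (max K₁ K₂) (fderiv ℝ f) (Metric.ball x₀ r) := by
    refine lipschitzOnWith_of_closed_cover (convex_ball x₀ r) hA hB (hDs.trans hAB) ?_ ?_
    · intro x hx y hy
      rw [(hdA x ⟨hDs hx.1, hx.2⟩).fderiv, (hdA y ⟨hDs hy.1, hy.2⟩).fderiv]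
      exact hK₁.weaken (le_max_left K₁ K₂) (hball hx.1).2.1 (hball hy.1).2.1
    · intro x hx y hy
      rw [(hdB x ⟨hDs hx.1, hx.2⟩).fderiv, (hdB y ⟨hDs hy.1, hy.2⟩).fderiv]
      exact hK₂.weaken (le_max_right K₁ K₂) (hball hx.1).2.2 (hball hy.1).2.2
  refine ⟨_, hDs, Metric.isOpen_ball, Metric.mem_ball_self hr, ?_, _, hlip⟩
  rw [show (1 : WithTop ℕ∞) = 0 + 1 by norm_num,
    contDiffOn_succ_iff_fderiv_of_isOpen Metric.isOpen_ball]
  exact ⟨hdiff, by simp, contDiffOn_zero.2 hlip.continuousOn⟩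

end ClosedCover

section ProductWithZero

variable {E F : Type*} [NormedAddCommGroup E] [NormedSpace ℝ E] [NormedAddCommGroup F]
  [NormedSpace ℝ F]

theorem hasFDerivAt_smul_of_continuousAt_of_eq_zero {θ : E → ℝ} {f : E → F} {f' : E →L[ℝ] F}
    {x : E} (hθ : ContinuousAt θ x) (hf : HasFDerivAt f f' x) (hfx : f x = 0) :
    HasFDerivAt (fun y => θ y • f y) (θ x • f') x := by
  have hrem : (fun y => (θ y - θ x) • f y) =o[𝓝 x] fun y => y - x := by
    have hθ₀ : (fun y => θ y - θ x) =o[𝓝 x] fun _ => (1 : ℝ) :=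
      (Asymptotics.isLittleO_one_iff ℝ).2 (tendsto_sub_nhds_zero_iff.2 hθ)
    simpa [hfx] using hθ₀.smul_isBigO hf.isBigO_sub.norm_right
  refine .of_isLittleO ((hrem.add (hf.isLittleO.const_smul_left (θ x))).congr_left fun y => ?_)
  simp only [Pi.smul_apply, hfx, smul_apply]
  module

theorem hasDerivAt_zero_of_hasDerivAt_deriv_id_mul {θ : ℝ → ℝ} {c : ℝ} (hθ : ContinuousAt θ 0)
    (hf : ∀ᶠ t in 𝓝 0, DifferentiableAt ℝ (fun t => t * θ t) t)
    (hc : HasDerivAt (deriv fun t => t * θ t) c 0) : HasDerivAt θ (c / 2) 0 := by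
  have hd₀ : deriv (fun t => t * θ t) 0 = θ 0 := by
    simpa [mul_comm] using
      (hasFDerivAt_smul_of_continuousAt_of_eq_zero hθ (hasFDerivAt_id 0) rfl).hasDerivAt.deriv
  rw [hasDerivAt_iff_tendsto_slope] at hc ⊢
  have hlim : Tendsto (fun t => (t * θ t - t * θ 0) / t ^ 2) (𝓝[≠] 0) (𝓝 (c / 2)) := by
    refine HasDerivAt.lhopital_zero_nhdsNE (f' := fun t => deriv (fun t => t * θ t) t - θ 0)
      (g' := fun t => 2 * t) ?_ ?_ ?_ ?_ ?_ ?_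
    · filter_upwards [hf.filter_mono nhdsWithin_le_nhds] with t ht
      exact ht.hasDerivAt.sub (by simpa using (hasDerivAt_id t).mul_const (θ 0))
    · exact .of_forall fun t => by simpa using hasDerivAt_pow 2 t
    · filter_upwards [self_mem_nhdsWithin] with t ht using mul_ne_zero two_ne_zero ht
    · have : ContinuousAt (fun t => t * θ t - t * θ 0) 0 := by fun_prop
      simpa using this.tendsto.mono_left nhdsWithin_le_nhds
    · simpa using ((continuous_pow 2).tendsto (0 : ℝ)).mono_left nhdsWithin_le_nhds
    · refine (hc.div_const 2).congr fun t => ?_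
      rw [slope_def_field, hd₀, sub_zero, div_div, mul_comm]
  refine hlim.congr' ?_
  filter_upwards [self_mem_nhdsWithin] with t ht
  have ht : t ≠ 0 := ht
  rw [slope_def_field]
  field_simp
  ring

theorem eq_of_contDiffAt_two_id_mul {θ : ℝ → ℝ} {c₁ c₂ : ℝ}
    (hf : ContDiffAt ℝ 2 (fun t => t * θ t) 0) (h₁ : HasDerivWithinAt θ c₁ (Set.Ici 0) 0)
    (h₂ : HasDerivWithinAt θ c₂ (Set.Iic 0) 0) : c₁ = c₂ := by
  have hcont : ContinuousAt θ 0 :=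
    continuousAt_iff_continuous_left_right.2 ⟨h₂.continuousWithinAt, h₁.continuousWithinAt⟩
  have hdiff : ∀ᶠ t in 𝓝 (0 : ℝ), DifferentiableAt ℝ (fun t => t * θ t) t :=
    (hf.eventually (by simp)).mono fun t ht => ht.differentiableAt two_ne_zero
  have hderiv : DifferentiableAt ℝ (deriv fun t => t * θ t) 0 :=
    (hf.derivWithin (m := 1) (by norm_num)).differentiableAt one_ne_zero
  have hθ := hasDerivAt_zero_of_hasDerivAt_deriv_id_mul hcont hdiff hderiv.hasDerivAt
  rw [(uniqueDiffOn_Ici 0 0 Set.self_mem_Ici).eq_deriv _ h₁ hθ.hasDerivWithinAt,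
    (uniqueDiffOn_Iic 0 0 Set.self_mem_Iic).eq_deriv _ h₂ hθ.hasDerivWithinAt]

end ProductWithZero

section StepSizeFunction

theorem hasDerivAt_one_sub_exp_neg (x : ℝ) :
    HasDerivAt (fun x => 1 - Real.exp (-x)) (Real.exp (-x)) x := by
  simpa using (hasDerivAt_neg x).exp.const_sub 1

theorem gecoPhi_zero : gecoPhi 0 = 1 := if_pos rfl

theorem mul_gecoPhi (x : ℝ) : x * gecoPhi x = 1 - Real.exp (-x) := by
  rcases eq_or_ne x 0 with rfl | hx
  · simp
  · rw [gecoPhi, if_neg hx, mul_div_cancel₀ _ hx]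

theorem exp_neg_eq_one_sub_mul_gecoPhi (x : ℝ) : Real.exp (-x) = 1 - x * gecoPhi x := by
  rw [mul_gecoPhi, sub_sub_cancel]

theorem gecoPhi_eq_dslope : gecoPhi = dslope (fun x => 1 - Real.exp (-x)) 0 := by
  funext x
  rcases eq_or_ne x 0 with rfl | hx
  · rw [gecoPhi_zero, dslope_same, (hasDerivAt_one_sub_exp_neg 0).deriv, neg_zero, Real.exp_zero]
  · simp [gecoPhi, hx, dslope_of_ne, slope_def_field]

theorem contDiff_gecoPhi {n : WithTop ℕ∞} : ContDiff ℝ n gecoPhi := by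
  refine contDiff_iff_contDiffAt.2 fun x => ?_
  rcases eq_or_ne x 0 with rfl | hx
  · have hana : AnalyticAt ℝ (fun x => 1 - Real.exp (-x)) 0 := by fun_prop
    obtain ⟨p, hp⟩ := hana
    rw [gecoPhi_eq_dslope]
    exact AnalyticAt.contDiffAt ⟨_, hp.has_fpower_series_dslope_fslope⟩
  · have hdiv : ContDiffAt ℝ n (fun x => (1 - Real.exp (-x)) / x) x := by
      fun_prop (disch := exact hx)
    refine hdiv.congr_of_eventuallyEq ?_
    filter_upwards [isOpen_ne.mem_nhds hx] with y hy using if_neg hy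

theorem hasDerivAt_gecoPhi_zero : HasDerivAt gecoPhi (-1 / 2) 0 := by
  have hderiv : deriv (fun x => x * gecoPhi x) = fun x => Real.exp (-x) := by
    simp only [mul_gecoPhi]
    exact deriv_eq hasDerivAt_one_sub_exp_neg
  have hexp : HasDerivAt (fun x => Real.exp (-x)) (-1) 0 := by
    simpa using (hasDerivAt_neg (0 : ℝ)).exp
  refine hasDerivAt_zero_of_hasDerivAt_deriv_id_mul
    (contDiff_gecoPhi (n := 0)).continuous.continuousAt (.of_forall fun x => ?_) (hderiv ▸ hexp)
  simp only [mul_gecoPhi]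
  exact (hasDerivAt_one_sub_exp_neg x).differentiableAt

/-- The factor `κ` in `w(y) = -κ f(y)` when the second stage damps the right-hand side by `e⁻ᵀ`,
that is, when `f(y⁽²⁾) = e⁻ᵀ f(y)`. -/
noncomputable def geco2Defect (T : ℝ) : ℝ := 1 + Real.exp (-T) - 2 * gecoPhi T

theorem mul_geco2Defect (T : ℝ) :
    T * geco2Defect T = T * (1 + Real.exp (-T)) - 2 * (1 - Real.exp (-T)) := by
  rw [geco2Defect, ← mul_gecoPhi]
  ring

theorem strictMono_mul_geco2Defect : StrictMono fun T => T * geco2Defect T := by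
  have hderiv (T : ℝ) :
      HasDerivAt (fun T => T * geco2Defect T) (1 - (T + 1) * Real.exp (-T)) T := by
    simp_rw [mul_geco2Defect]
    exact (((hasDerivAt_id' T).mul ((hasDerivAt_neg T).exp.const_add 1)).sub
      ((hasDerivAt_one_sub_exp_neg T).const_mul 2)).congr_deriv (by ring)
  have hpos {T : ℝ} (hT : T ≠ 0) : 0 < deriv (fun T => T * geco2Defect T) T := by
    rw [(hderiv T).deriv, sub_pos, Real.exp_neg, mul_inv_lt_iff₀ (Real.exp_pos T), one_mul]
    exact Real.add_one_lt_exp hT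
  have hcont : Continuous fun T => T * geco2Defect T :=
    continuous_iff_continuousAt.2 fun T => (hderiv T).continuousAt
  refine StrictMonoOn.Iic_union_Ici (a := 0) ?_ ?_
  · refine strictMonoOn_of_deriv_pos (convex_Iic 0) hcont.continuousOn fun T hT => hpos ?_
    exact (interior_Iic.subset hT).ne
  · refine strictMonoOn_of_deriv_pos (convex_Ici 0) hcont.continuousOn fun T hT => hpos ?_
    exact (interior_Ici.subset hT).ne'

theorem geco2Defect_pos {T : ℝ} (hT : T ≠ 0) : 0 < geco2Defect T := by
  rcases hT.lt_or_gt with hT | hT <;> have := strictMono_mul_geco2Defect hT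
  · exact pos_of_mul_neg_right (by simpa only [zero_mul] using this) hT.le
  · exact pos_of_mul_pos_right (by simpa only [zero_mul] using this) hT.le

theorem geco2Defect_nonneg (T : ℝ) : 0 ≤ geco2Defect T := by
  rcases eq_or_ne T 0 with rfl | hT
  · norm_num [geco2Defect, gecoPhi_zero]
  · exact (geco2Defect_pos hT).le

end StepSizeFunction

section Dynamics

variable {X P F : Type*} [TopologicalSpace X] [TopologicalSpace P] [SeminormedAddCommGroup F]
  {g : X → X} {p : X → P} {h : X → F} {x₀ : X}

theorem exists_mapsTo_subset_of_nonexpanding {V : Set X}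
    (hind : IsInducing fun x => (p x, h x)) (hx₀ : h x₀ = 0) (hp : ∀ᶠ x in 𝓝 x₀, p (g x) = p x)
    (hh : ∀ᶠ x in 𝓝 x₀, ‖h (g x)‖ ≤ ‖h x‖) (hV : V ∈ 𝓝 x₀) :
    ∃ W ∈ 𝓝 x₀, W ⊆ V ∧ Set.MapsTo g W W := by
  have hgood := inter_mem hV (inter_mem hp hh)
  rw [hind.nhds_eq_comap, hx₀, nhds_prod_eq] at hgood
  obtain ⟨_, hS, hSgood⟩ := hgood
  obtain ⟨U, hU, B, hB, hUB⟩ := mem_prod_iff.1 hS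
  obtain ⟨r, hr, hrB⟩ := Metric.mem_nhds_iff.1 hB
  have hsub : ∀ x, p x ∈ U → ‖h x‖ < r → x ∈ V ∧ p (g x) = p x ∧ ‖h (g x)‖ ≤ ‖h x‖ :=
    fun x hxU hxr => hSgood (hUB ⟨hxU, hrB (mem_ball_zero_iff.2 hxr)⟩)
  refine ⟨{x | p x ∈ U ∧ ‖h x‖ < r}, ?_, fun x hx => (hsub x hx.1 hx.2).1, fun x hx => ?_⟩
  · rw [hind.nhds_eq_comap, hx₀]
    refine ⟨U ×ˢ Metric.ball 0 r, prod_mem_nhds hU (Metric.ball_mem_nhds 0 hr), fun x hx => ?_⟩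
    exact ⟨hx.1, mem_ball_zero_iff.1 hx.2⟩
  · obtain ⟨-, hpx, hhx⟩ := hsub x hx.1 hx.2
    exact ⟨by rw [hpx]; exact hx.1, hhx.trans_lt hx.2⟩

theorem eventually_forall_iterate_mem_of_nonexpanding {V : Set X}
    (hind : IsInducing fun x => (p x, h x)) (hx₀ : h x₀ = 0) (hp : ∀ᶠ x in 𝓝 x₀, p (g x) = p x)
    (hh : ∀ᶠ x in 𝓝 x₀, ‖h (g x)‖ ≤ ‖h x‖) (hV : V ∈ 𝓝 x₀) :
    ∀ᶠ x in 𝓝 x₀, ∀ n : ℕ, g^[n] x ∈ V := by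
  obtain ⟨W, hW, hWV, hmaps⟩ := exists_mapsTo_subset_of_nonexpanding hind hx₀ hp hh hV
  filter_upwards [hW] with x hx n using hWV (hmaps.iterate n hx)

theorem eventually_tendsto_iterate_of_contracting {ρ : ℝ} (hind : IsInducing fun x => (p x, h x))
    (hx₀ : h x₀ = 0) (hp : ∀ᶠ x in 𝓝 x₀, p (g x) = p x) (hρ₀ : 0 ≤ ρ) (hρ : ρ < 1)
    (hh : ∀ᶠ x in 𝓝 x₀, ‖h (g x)‖ ≤ ρ * ‖h x‖) :
    ∀ᶠ x in 𝓝 x₀, p x = p x₀ → Tendsto (fun n : ℕ => g^[n] x) atTop (𝓝 x₀) := by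
  have hh₁ : ∀ᶠ x in 𝓝 x₀, ‖h (g x)‖ ≤ ‖h x‖ := hh.mono fun x hx =>
    hx.trans (mul_le_of_le_one_left (norm_nonneg _) hρ.le)
  filter_upwards [eventually_forall_iterate_mem_of_nonexpanding hind hx₀ hp hh₁
    (inter_mem hp hh)] with x hx hpx
  have hpconst : ∀ n, p (g^[n] x) = p x₀ := fun n => by
    induction n with
    | zero => exact hpx
    | succ n ih =>
      rw [Function.iterate_succ_apply', ← ih]
      exact (hx n).1
  have hdecay : ∀ n, ‖h (g^[n] x)‖ ≤ ρ ^ n * ‖h x‖ := fun n =>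
    le_geom (u := fun n => ‖h (g^[n] x)‖) hρ₀ n fun k _ => by
      rw [Function.iterate_succ_apply']
      exact (hx k).2
  have hzero : Tendsto (fun n => h (g^[n] x)) atTop (𝓝 (h x₀)) := by
    rw [hx₀]
    refine squeeze_zero_norm hdecay ?_
    simpa using (tendsto_pow_atTop_nhds_zero_of_lt_one hρ₀ hρ).mul_const ‖h x‖
  rw [hind.tendsto_nhds_iff]
  exact (tendsto_const_nhds.congr fun n => (hpconst n).symm).prodMk_nhds hzero

section Stability

variable {ι : Type*} [Fintype ι] {g : (ι → ℝ) → ι → ℝ} {h : (ι → ℝ) → F} {D : Set (ι → ℝ)}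
  {y : ι → ℝ}

theorem isLyapunovStable_of_forall_eventually (hfix : g y = y)
    (hst : ∀ V ∈ 𝓝 y, ∀ᶠ x in 𝓝 y, ∀ n : ℕ, g^[n] x ∈ V) : IsLyapunovStable g D y := by
  refine ⟨hfix, fun ε hε => ?_⟩
  obtain ⟨δ, hδ, hball⟩ := Metric.eventually_nhds_iff.1 (hst _ (Metric.ball_mem_nhds y hε))
  simp only [dist_eq_norm, Metric.mem_ball] at hball
  exact ⟨δ, hδ, fun y₀ _ hy₀ => hball hy₀⟩

theorem not_isLyapunovStable_of_expanding {ρ : ℝ} (hcont : ContinuousAt h y) (hρ : 1 < ρ)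
    (hh : ∀ᶠ x in 𝓝 y, ρ * ‖h x‖ ≤ ‖h (g x)‖) (hfreq : ∃ᶠ x in 𝓝 y, x ∈ D ∧ ‖h x‖ ≠ 0) :
    ¬ IsLyapunovStable g D y := by
  rintro ⟨-, hst⟩
  simp only [← dist_eq_norm] at hst
  have hbdd : ∀ᶠ x in 𝓝 y, ‖h x‖ < ‖h y‖ + 1 := hcont.norm.eventually_lt_const (lt_add_one _)
  obtain ⟨ε, hε, hball⟩ := Metric.eventually_nhds_iff.1 (hh.and hbdd)
  obtain ⟨δ, hδ, hstay⟩ := hst ε hε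
  obtain ⟨x, ⟨hxD, hx⟩, hxδ⟩ := (hfreq.and_eventually (Metric.ball_mem_nhds y hδ)).exists
  have horbit : ∀ n : ℕ, ρ * ‖h (g^[n] x)‖ ≤ ‖h (g (g^[n] x))‖ ∧ ‖h (g^[n] x)‖ < ‖h y‖ + 1 :=
    fun n => hball (hstay x hxD hxδ n)
  have hgrow : Tendsto (fun n : ℕ => ‖h (g^[n] x)‖) atTop atTop :=
    tendsto_atTop_of_geom_le ((norm_nonneg _).lt_of_ne' hx) hρ fun n => by
      rw [Function.iterate_succ_apply']
      exact (horbit n).1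
  obtain ⟨n, hn⟩ := (hgrow.eventually_ge_atTop (‖h y‖ + 1)).exists
  exact (horbit n).2.not_ge hn

end Stability

end Dynamics

section RankOneStep

variable {E : Type*} [NormedAddCommGroup E] [NormedSpace ℝ E]

/-- A step `x + ω(x) ℓ(x) v` along the fixed direction `v`; it is what a one-step method makes of
the linear equation `x' = ℓ(x) v`, whose equilibria are the zeros of `ℓ`. -/
def rankOneStep (ℓ : E →L[ℝ] ℝ) (v : E) (ω : E → ℝ) (x : E) : E := x + (ω x * ℓ x) • v

/-- The quantity `ℓ(v) x - ℓ(x) v`, which every step along `v` conserves. -/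
def rankOneInvariant (ℓ : E →L[ℝ] ℝ) (v : E) : E →L[ℝ] E :=
  ℓ v • ContinuousLinearMap.id ℝ E - ℓ.smulRight v

variable {ℓ : E →L[ℝ] ℝ} {v x y : E} {ω ω₁ ω₂ : E → ℝ} {g : E → E} {s : Set E}

theorem rankOneStep_of_apply_eq_zero (hx : ℓ x = 0) : rankOneStep ℓ v ω x = x := by
  rw [rankOneStep, hx, mul_zero, zero_smul, add_zero]

theorem apply_rankOneStep : ℓ (rankOneStep ℓ v ω x) = (1 + ω x * ℓ v) * ℓ x := by
  simp only [rankOneStep, map_add, map_smul, smul_eq_mul]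
  ring

theorem rankOneInvariant_apply : rankOneInvariant ℓ v x = ℓ v • x - ℓ x • v := rfl

theorem rankOneInvariant_self : rankOneInvariant ℓ v v = 0 := sub_self _

theorem rankOneInvariant_rankOneStep :
    rankOneInvariant ℓ v (rankOneStep ℓ v ω x) = rankOneInvariant ℓ v x := by
  rw [rankOneStep, map_add, map_smul, rankOneInvariant_self, smul_zero, add_zero]

theorem rankOneInvariant_eq_of_sub_mem_span (h : x - y ∈ Submodule.span ℝ {v}) :
    rankOneInvariant ℓ v x = rankOneInvariant ℓ v y := by
  obtain ⟨t, ht⟩ := Submodule.mem_span_singleton.1 h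
  rw [← sub_eq_zero, ← map_sub, ← ht, map_smul, rankOneInvariant_self, smul_zero]

theorem isInducing_rankOneInvariant_prodMk (hv : ℓ v ≠ 0) :
    IsInducing fun x => (rankOneInvariant ℓ v x, ℓ x) := by
  refine (Function.LeftInverse.isEmbedding (f := fun q : E × ℝ => (ℓ v)⁻¹ • (q.1 + q.2 • v))
    (fun x => ?_) (by fun_prop) (by fun_prop)).isInducing
  simp only [rankOneInvariant_apply, sub_add_cancel, inv_smul_smul₀ hv]

theorem hasFDerivAt_rankOneStep (hω : ContinuousAt ω x) (hx : ℓ x = 0) :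
    HasFDerivAt (rankOneStep ℓ v ω) (.id ℝ E + (ω x • ℓ).smulRight v) x :=
  (hasFDerivAt_id x).add
    ((hasFDerivAt_smul_of_continuousAt_of_eq_zero hω ℓ.hasFDerivAt hx).smul_const v)

theorem exists_contDiffOn_one_of_eqOn_rankOneStep (hs : IsOpen s) (hy : y ∈ s)
    (hg : Set.EqOn g (rankOneStep ℓ v ω) s) (h₁ : ∀ x ∈ s, 0 ≤ ℓ x → ω x = ω₁ x)
    (h₂ : ∀ x ∈ s, ℓ x ≤ 0 → ω x = ω₂ x) (hω₁ : ContDiffOn ℝ 2 ω₁ s) (hω₂ : ContDiffOn ℝ 2 ω₂ s) :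
    ∃ D ⊆ s, IsOpen D ∧ y ∈ D ∧ ContDiffOn ℝ 1 g D ∧
      ∃ K : ℝ≥0, LipschitzOnWith K (fderiv ℝ g) D := by
  have hstep {τ : E → ℝ} (hτ : ContDiffOn ℝ 2 τ s) : ContDiffOn ℝ 2 (rankOneStep ℓ v τ) s :=
    contDiffOn_id.add ((hτ.mul ℓ.contDiff.contDiffOn).smul contDiffOn_const)
  have hfderiv {τ : E → ℝ} (hτ : ContDiffOn ℝ 2 τ s) {x : E} (hx : x ∈ s) (hℓx : ℓ x = 0) :
      fderiv ℝ (rankOneStep ℓ v τ) x = .id ℝ E + (τ x • ℓ).smulRight v :=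
    (hasFDerivAt_rankOneStep (hτ.continuousOn.continuousAt (hs.mem_nhds hx)) hℓx).fderiv
  refine exists_contDiffOn_one_lipschitzOnWith_fderiv_of_closed_cover (A := {x | 0 ≤ ℓ x})
    (B := {x | ℓ x ≤ 0}) hs hy (isClosed_le continuous_const ℓ.continuous)
    (isClosed_le ℓ.continuous continuous_const) (fun x _ => le_total 0 (ℓ x)) ?_ ?_
    (hstep hω₁) (hstep hω₂) fun x hx hx₁ hx₂ => ?_
  · exact fun x hx => by rw [hg hx.1, rankOneStep, h₁ x hx.1 hx.2, rankOneStep]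
  · exact fun x hx => by rw [hg hx.1, rankOneStep, h₂ x hx.1 hx.2, rankOneStep]
  · have hℓx : ℓ x = 0 := le_antisymm hx₂ hx₁
    rw [hfderiv hω₁ hx hℓx, hfderiv hω₂ hx hℓx, ← h₁ x hx hx₁, ← h₂ x hx hx₂]

theorem apply_eq_of_contDiffAt_two_of_eventuallyEq_rankOneStep {ω₁' ω₂' : E →L[ℝ] ℝ}
    (hC : ContDiffAt ℝ 2 g y) (hg : g =ᶠ[𝓝 y] rankOneStep ℓ v ω) (hy : ℓ y = 0) (hv : ℓ v ≠ 0)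
    (h₁ : ∀ᶠ x in 𝓝 y, 0 ≤ ℓ x → ω x = ω₁ x) (h₂ : ∀ᶠ x in 𝓝 y, ℓ x ≤ 0 → ω x = ω₂ x)
    (hω₁ : HasFDerivAt ω₁ ω₁' y) (hω₂ : HasFDerivAt ω₂ ω₂' y) : ω₁' v = ω₂' v := by
  set u : E := (ℓ v)⁻¹ • v with hu
  have hℓ (t : ℝ) : ℓ (y + t • u) = t := by
    rw [hu, map_add, map_smul, map_smul, hy, zero_add, smul_eq_mul, smul_eq_mul,
      inv_mul_cancel₀ hv, mul_one]
  have hline : Tendsto (fun t : ℝ => y + t • u) (𝓝 0) (𝓝 y) :=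
    Continuous.tendsto' (by fun_prop) 0 y (by rw [zero_smul, add_zero])
  have hsmooth : ContDiffAt ℝ 2 (fun t : ℝ => t * ω (y + t • u)) 0 := by
    have hgline : ContDiffAt ℝ 2 (fun t : ℝ => (ℓ v)⁻¹ * (ℓ (g (y + t • u)) - t)) 0 := by
      have hgy : ContDiffAt ℝ 2 g (y + (0 : ℝ) • u) := by rwa [zero_smul, add_zero]
      have := hgy.comp (0 : ℝ) (f := fun t : ℝ => y + t • u) (by fun_prop)
      exact contDiffAt_const.mul ((ℓ.contDiff.contDiffAt.comp 0 this).sub contDiffAt_id)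
    refine hgline.congr_of_eventuallyEq ?_
    filter_upwards [hline.eventually hg] with t ht
    rw [ht, apply_rankOneStep, hℓ]
    field_simp
    ring
  have hderiv {τ : E → ℝ} {τ' : E →L[ℝ] ℝ} {S : Set ℝ} (hτ : HasFDerivAt τ τ' y) (h0 : 0 ∈ S)
      (heq : ∀ᶠ t in 𝓝 0, t ∈ S → ω (y + t • u) = τ (y + t • u)) :
      HasDerivWithinAt (fun t : ℝ => ω (y + t • u)) (τ' u) S 0 := by
    have hτline : HasDerivAt (fun t : ℝ => τ (y + t • u)) (τ' u) 0 := hτ.hasLineDerivAt u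
    exact hτline.hasDerivWithinAt.congr_of_eventuallyEq (eventually_nhdsWithin_iff.2 heq)
      (heq.self_of_nhds h0)
  have hpos := hline.eventually h₁
  have hneg := hline.eventually h₂
  simp only [hℓ] at hpos hneg
  have := eq_of_contDiffAt_two_id_mul hsmooth (hderiv hω₁ Set.self_mem_Ici hpos)
    (hderiv hω₂ Set.self_mem_Iic hneg)
  rwa [hu, map_smul, map_smul, smul_right_inj (inv_ne_zero hv)] at this

theorem eventually_norm_apply_le_of_eventuallyEq_rankOneStep {ρ : ℝ}
    (hg : g =ᶠ[𝓝 y] rankOneStep ℓ v ω) (hω : ContinuousAt ω y) (hρ : |1 + ω y * ℓ v| < ρ) :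
    ∀ᶠ x in 𝓝 y, ‖ℓ (g x)‖ ≤ ρ * ‖ℓ x‖ := by
  have hcont : ContinuousAt (fun x => |1 + ω x * ℓ v|) y := by fun_prop
  filter_upwards [hg, hcont.eventually_lt_const hρ] with x hgx hx
  rw [hgx, apply_rankOneStep, norm_mul]
  exact mul_le_mul_of_nonneg_right hx.le (norm_nonneg _)

theorem eventually_le_norm_apply_of_eventuallyEq_rankOneStep {ρ : ℝ}
    (hg : g =ᶠ[𝓝 y] rankOneStep ℓ v ω) (hω : ContinuousAt ω y) (hρ : ρ < |1 + ω y * ℓ v|) :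
    ∀ᶠ x in 𝓝 y, ρ * ‖ℓ x‖ ≤ ‖ℓ (g x)‖ := by
  have hcont : ContinuousAt (fun x => |1 + ω x * ℓ v|) y := by fun_prop
  filter_upwards [hg, hcont.eventually_const_lt hρ] with x hgx hx
  rw [hgx, apply_rankOneStep, norm_mul]
  exact mul_le_mul_of_nonneg_right hx.le (norm_nonneg _)

theorem eventually_rankOneInvariant_of_eventuallyEq_rankOneStep
    (hg : g =ᶠ[𝓝 y] rankOneStep ℓ v ω) :
    ∀ᶠ x in 𝓝 y, rankOneInvariant ℓ v (g x) = rankOneInvariant ℓ v x :=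
  hg.mono fun x hx => by rw [hx, rankOneInvariant_rankOneStep]

theorem eventually_tendsto_iterate_of_eventuallyEq_rankOneStep
    (hg : g =ᶠ[𝓝 y] rankOneStep ℓ v ω) (hω : ContinuousAt ω y) (hy : ℓ y = 0)
    (hlt : |1 + ω y * ℓ v| < 1) :
    ∀ᶠ x in 𝓝 y, x - y ∈ Submodule.span ℝ {v} →
      Tendsto (fun n : ℕ => g^[n] x) atTop (𝓝 y) := by
  obtain ⟨ρ, hρ, hρ₁⟩ := exists_between hlt
  have hv : ℓ v ≠ 0 := fun h => by simp [h] at hlt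
  filter_upwards [eventually_tendsto_iterate_of_contracting (isInducing_rankOneInvariant_prodMk hv)
    hy (eventually_rankOneInvariant_of_eventuallyEq_rankOneStep hg)
    ((abs_nonneg _).trans hρ.le) hρ₁
    (eventually_norm_apply_le_of_eventuallyEq_rankOneStep hg hω hρ)] with x hx hxy
  exact hx (rankOneInvariant_eq_of_sub_mem_span hxy)

theorem frequently_apply_ne_zero (hℓ : ℓ ≠ 0) (y : E) : ∃ᶠ x in 𝓝 y, ℓ x ≠ 0 := fun h => by
  have hzero : ℓ =ᶠ[𝓝 y] fun _ => 0 := h.mono fun x => not_not.1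
  exact hℓ (ℓ.hasFDerivAt.unique ((hasFDerivAt_const 0 y).congr_of_eventuallyEq hzero))

section Stability

variable {ι : Type*} [Fintype ι] {ℓ : (ι → ℝ) →L[ℝ] ℝ} {v y : ι → ℝ} {ω : (ι → ℝ) → ℝ}
  {g : (ι → ℝ) → ι → ℝ} {D : Set (ι → ℝ)}

theorem isLyapunovStable_of_eventuallyEq_rankOneStep (hg : g =ᶠ[𝓝 y] rankOneStep ℓ v ω)
    (hω : ContinuousAt ω y) (hy : ℓ y = 0) (hlt : |1 + ω y * ℓ v| < 1) :
    IsLyapunovStable g D y := by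
  have hv : ℓ v ≠ 0 := fun h => by simp [h] at hlt
  refine isLyapunovStable_of_forall_eventually
    (hg.self_of_nhds.trans (rankOneStep_of_apply_eq_zero hy)) fun V hV =>
    eventually_forall_iterate_mem_of_nonexpanding (isInducing_rankOneInvariant_prodMk hv) hy
      (eventually_rankOneInvariant_of_eventuallyEq_rankOneStep hg) ?_ hV
  simpa only [one_mul] using eventually_norm_apply_le_of_eventuallyEq_rankOneStep hg hω hlt

theorem isUnstable_of_eventuallyEq_rankOneStep (hg : g =ᶠ[𝓝 y] rankOneStep ℓ v ω)
    (hω : ContinuousAt ω y) (hy : ℓ y = 0) (hD : D ∈ 𝓝 y) (hlt : 1 < |1 + ω y * ℓ v|) :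
    IsUnstable g D y := by
  obtain ⟨ρ, hρ₁, hρ⟩ := exists_between hlt
  have hℓ : ℓ ≠ 0 := fun h => by simp [h] at hlt
  refine ⟨hg.self_of_nhds.trans (rankOneStep_of_apply_eq_zero hy),
    not_isLyapunovStable_of_expanding ℓ.continuous.continuousAt hρ₁
      (eventually_le_norm_apply_of_eventuallyEq_rankOneStep hg hω hρ) ?_⟩
  exact ((frequently_apply_ne_zero hℓ y).and_eventually hD).mono fun x hx =>
    ⟨hx.2, norm_ne_zero_iff.2 hx.1⟩

end Stability

end RankOneStep

section RankOneSystem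

variable {ι : Type*} [Fintype ι] {P S : Matrix ι ι ℝ} {l v w y : ι → ℝ} {Δt s : ℝ}

theorem isOpen_posVectors (ι : Type*) [Finite ι] : IsOpen (posVectors ι) := by
  simp only [posVectors, Set.ofPred_forall]
  exact isOpen_iInter_of_finite fun i => isOpen_lt continuous_const (continuous_apply i)

theorem sum_mulVec_div_of_isDiag (hS : S.IsDiag) (hy : ∀ i, y i ≠ 0) :
    ∑ i, (S *ᵥ y) i / y i = S.trace := by
  classical
  refine Finset.sum_congr rfl fun i _ => ?_
  rw [← hS.diagonal_diag, Matrix.mulVec_diagonal, mul_div_cancel_right₀ _ (hy i),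
    Matrix.diag_diagonal]

/-- The linear functional `y ↦ l ⬝ᵥ y`. -/
noncomputable def dotFunctional (l : ι → ℝ) : (ι → ℝ) →L[ℝ] ℝ :=
  LinearMap.toContinuousLinearMap (dotProductBilin ℝ ℝ l)

theorem dotFunctional_apply : dotFunctional l y = l ⬝ᵥ y := rfl

/-- `y' = P y - S y` is a production-destruction system whose system matrix `P - S` has the rank-one
factorization `v lᵀ`; the destruction matrix `S` is diagonal, and the production matrix `P` has
trace zero, as it does when no component produces itself. -/
structure IsRankOneSystem (P S : Matrix ι ι ℝ) (l v : ι → ℝ) : Prop where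
  isDiag : S.IsDiag
  trace_production : P.trace = 0
  sub_eq : P - S = Matrix.vecMulVec v l

/-- The map generating the GeCo2 iterates for the linear system `y' = P y - S y`. -/
noncomputable def linearGeco2Map (P S : Matrix ι ι ℝ) (Δt : ℝ) : (ι → ℝ) → ι → ℝ :=
  geco2Step (P *ᵥ ·) (S *ᵥ ·) Δt

/-- The gain `½ Δt (1 + e⁻ᵀ)`, `T = Δt s`, of a GeCo2 step with trivial outer weight, where `s` is
the trace of the destruction matrix. -/
noncomputable def geco2Gain (Δt s : ℝ) : ℝ := Δt / 2 * (1 + Real.exp (-(Δt * s)))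

/-- The weight `ω` for which the GeCo2 step of a rank-one system is `y + ω(y) (l ⬝ᵥ y) v`. -/
noncomputable def geco2RankOneWeight (l v : ι → ℝ) (Δt s : ℝ) (y : ι → ℝ) : ℝ :=
  geco2Gain Δt s *
    gecoPhi (Δt * ∑ i, max 0 (-(geco2Defect (Δt * s) * (l ⬝ᵥ y)) * v i) / y i)

/-- The smooth function that `geco2RankOneWeight` coincides with on a half space `0 ≤ l ⬝ᵥ y` or
`l ⬝ᵥ y ≤ 0`, for `w = v⁻` or `w = -v⁺` respectively. -/
noncomputable def geco2BranchWeight (l w : ι → ℝ) (Δt s : ℝ) (y : ι → ℝ) : ℝ :=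
  geco2Gain Δt s *
    gecoPhi (Δt * geco2Defect (Δt * s) * ((∑ i, w i / y i) * (l ⬝ᵥ y)))

theorem geco2Gain_eq : geco2Gain Δt s = Δt - 1 / 2 * gecoPhi (Δt * s) * Δt ^ 2 * s := by
  rw [geco2Gain, exp_neg_eq_one_sub_mul_gecoPhi]
  ring

theorem geco2Gain_ne_zero (hΔt : Δt ≠ 0) : geco2Gain Δt s ≠ 0 :=
  mul_ne_zero (div_ne_zero hΔt two_ne_zero) (by positivity)

namespace IsRankOneSystem

variable (hsys : IsRankOneSystem P S l v)
include hsys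

theorem mulVec_sub_mulVec (y : ι → ℝ) : P *ᵥ y - S *ᵥ y = (l ⬝ᵥ y) • v := by
  rw [← Matrix.sub_mulVec, hsys.sub_eq, Matrix.vecMulVec_mulVec, op_smul_eq_smul]

theorem dotProduct_eq : l ⬝ᵥ v = -S.trace := by
  rw [dotProduct_comm, ← Matrix.trace_vecMulVec, ← hsys.sub_eq, Matrix.trace_sub,
    hsys.trace_production, zero_sub]

theorem gecoWeight_eq (hy : ∀ i, y i ≠ 0) :
    gecoWeight (S *ᵥ ·) Δt y = gecoPhi (Δt * S.trace) := by
  rw [gecoWeight, sum_mulVec_div_of_isDiag hsys.isDiag hy]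

theorem dotProduct_geco2Stage (hy : ∀ i, y i ≠ 0) :
    l ⬝ᵥ geco2Stage (P *ᵥ ·) (S *ᵥ ·) Δt y = Real.exp (-(Δt * S.trace)) * (l ⬝ᵥ y) := by
  rw [geco2Stage, hsys.gecoWeight_eq hy, hsys.mulVec_sub_mulVec, dotProduct_add, dotProduct_smul,
    dotProduct_smul, hsys.dotProduct_eq, smul_eq_mul, smul_eq_mul,
    exp_neg_eq_one_sub_mul_gecoPhi]
  ring

theorem geco2W_eq (hy : ∀ i, y i ≠ 0) :
    geco2W (P *ᵥ ·) (S *ᵥ ·) Δt y = (-(geco2Defect (Δt * S.trace) * (l ⬝ᵥ y))) • v := by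
  simp only [geco2W, hsys.mulVec_sub_mulVec, hsys.gecoWeight_eq hy, hsys.dotProduct_geco2Stage hy,
    geco2Defect]
  module

theorem linearGeco2Map_eq_rankOneStep (hy : ∀ i, y i ≠ 0) :
    linearGeco2Map P S Δt y =
      rankOneStep (dotFunctional l) v (geco2RankOneWeight l v Δt S.trace) y := by
  simp only [linearGeco2Map, geco2Step, rankOneStep, geco2RankOneWeight, geco2Gain,
    hsys.geco2W_eq hy, hsys.mulVec_sub_mulVec, hsys.dotProduct_geco2Stage hy, dotFunctional_apply,
    Pi.smul_apply, smul_eq_mul]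
  module

theorem dotProduct_eq_zero_of_mulVec_eq_zero (htr : S.trace ≠ 0) (hy : (P - S) *ᵥ y = 0) :
    l ⬝ᵥ y = 0 := by
  rw [Matrix.sub_mulVec, hsys.mulVec_sub_mulVec] at hy
  refine (smul_eq_zero.1 hy).resolve_right fun hv => htr ?_
  rw [← neg_eq_zero, ← hsys.dotProduct_eq, hv, dotProduct_zero]

end IsRankOneSystem

theorem geco2RankOneWeight_of_dotProduct_eq_zero (hy : l ⬝ᵥ y = 0) :
    geco2RankOneWeight l v Δt s y = geco2Gain Δt s := by
  simp [geco2RankOneWeight, hy, gecoPhi_zero]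

theorem geco2RankOneWeight_eq_branchWeight
    (hw : ∀ i, max 0 (-(l ⬝ᵥ y) * v i) = (l ⬝ᵥ y) * w i) :
    geco2RankOneWeight l v Δt s y = geco2BranchWeight l w Δt s y := by
  rw [geco2RankOneWeight, geco2BranchWeight, mul_assoc Δt, Finset.sum_mul,
    Finset.mul_sum _ _ (geco2Defect _)]
  refine congrArg (fun r => geco2Gain Δt s * gecoPhi (Δt * r)) (Finset.sum_congr rfl fun i _ => ?_)
  set d := geco2Defect (Δt * s)
  calc max 0 (-(d * (l ⬝ᵥ y)) * v i) / y i = max 0 (d * (-(l ⬝ᵥ y) * v i)) / y i := by ring_nf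
    _ = d * max 0 (-(l ⬝ᵥ y) * v i) / y i := by
      rw [mul_max_of_nonneg _ _ (geco2Defect_nonneg _), mul_zero]
    _ = d * (w i / y i * (l ⬝ᵥ y)) := by
      rw [hw]
      ring

theorem geco2RankOneWeight_of_nonneg (hy : 0 ≤ l ⬝ᵥ y) :
    geco2RankOneWeight l v Δt s y = geco2BranchWeight l v⁻ Δt s y :=
  geco2RankOneWeight_eq_branchWeight fun i => by
    rw [Pi.negPart_apply, negPart_def, mul_max_of_nonneg _ _ hy, mul_zero, max_comm, neg_mul_comm]

theorem geco2RankOneWeight_of_nonpos (hy : l ⬝ᵥ y ≤ 0) :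
    geco2RankOneWeight l v Δt s y = geco2BranchWeight l (-v⁺) Δt s y :=
  geco2RankOneWeight_eq_branchWeight fun i => by
    rw [Pi.neg_apply, Pi.posPart_apply, posPart_def, ← neg_mul_comm,
      mul_max_of_nonneg _ _ (neg_nonneg.2 hy), mul_zero, max_comm]

theorem continuousAt_geco2RankOneWeight (hy : ∀ i, y i ≠ 0) :
    ContinuousAt (geco2RankOneWeight l v Δt s) y := by
  have hφ : Continuous gecoPhi := (contDiff_gecoPhi (n := 0)).continuous
  unfold geco2RankOneWeight
  fun_prop (disch := exact hy _)

theorem contDiffAt_sum_div {n : WithTop ℕ∞} (hy : ∀ i, y i ≠ 0) :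
    ContDiffAt ℝ n (fun x : ι → ℝ => ∑ i, w i / x i) y :=
  .sum fun i _ => contDiffAt_const.div (contDiff_apply ℝ ℝ i).contDiffAt (hy i)

theorem contDiffAt_geco2BranchWeight {n : WithTop ℕ∞} (hy : ∀ i, y i ≠ 0) :
    ContDiffAt ℝ n (geco2BranchWeight l w Δt s) y :=
  contDiffAt_const.mul (contDiff_gecoPhi.contDiffAt.comp y
    (contDiffAt_const.mul ((contDiffAt_sum_div hy).mul (dotFunctional l).contDiff.contDiffAt)))

theorem hasFDerivAt_geco2BranchWeight (hy : ∀ i, y i ≠ 0) (hly : l ⬝ᵥ y = 0) :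
    HasFDerivAt (geco2BranchWeight l w Δt s)
      ((geco2Gain Δt s * (-1 / 2 * (Δt * geco2Defect (Δt * s) * ∑ i, w i / y i))) •
        dotFunctional l) y := by
  have hsum : ContinuousAt (fun x : ι → ℝ => ∑ i, w i / x i) y :=
    (contDiffAt_sum_div (n := 0) hy).continuousAt
  have hinner := (hasFDerivAt_smul_of_continuousAt_of_eq_zero hsum
    (dotFunctional l).hasFDerivAt hly).const_mul (Δt * geco2Defect (Δt * s))
  have hφ : HasDerivAt gecoPhi (-1 / 2)
      (Δt * geco2Defect (Δt * s) * ((∑ i, w i / y i) * dotFunctional l y)) := by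
    rw [dotFunctional_apply, hly, mul_zero, mul_zero]
    exact hasDerivAt_gecoPhi_zero
  refine ((hφ.comp_hasFDerivAt y hinner).const_mul (geco2Gain Δt s)).congr_fderiv ?_
  simp only [smul_smul, mul_assoc]

/-- The polynomial `1 + z + ½ z² φ(T)`, for `T = Δt tr S` the stability function of the GeCo2 step
with step size `Δt` and destruction matrix `S`. -/
noncomputable def geco2StabilityPolynomial (T : ℝ) : Polynomial ℝ :=
  1 + Polynomial.X + Polynomial.C (1 / 2 * gecoPhi T) * Polynomial.X ^ 2

theorem eval_geco2StabilityPolynomial :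
    (geco2StabilityPolynomial (Δt * s)).eval (-Δt * s) = 1 + geco2Gain Δt s * -s := by
  simp only [geco2StabilityPolynomial, Polynomial.eval_add, Polynomial.eval_mul,
    Polynomial.eval_pow, Polynomial.eval_one, Polynomial.eval_X, Polynomial.eval_C, geco2Gain_eq]
  ring

theorem aeval_geco2StabilityPolynomial_vecMulVec [DecidableEq ι] (hlv : l ⬝ᵥ v = -s) :
    Polynomial.aeval (Δt • Matrix.vecMulVec v l) (geco2StabilityPolynomial (Δt * s)) =
      1 + geco2Gain Δt s • Matrix.vecMulVec v l := by
  have hsq : (Matrix.vecMulVec v l) ^ 2 = -s • Matrix.vecMulVec v l := by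
    rw [sq, Matrix.vecMulVec_mul_vecMulVec, hlv, Matrix.vecMulVec_smul]
  simp only [geco2StabilityPolynomial, map_add, map_mul, map_pow, map_one, Polynomial.aeval_X,
    Polynomial.aeval_C, smul_pow, hsq, geco2Gain_eq, mul_assoc,
    ← Algebra.smul_def]
  module

theorem roots_charpoly_one_add_vecMulVec {R : Type*} [CommRing R] [IsDomain R]
    [DecidableEq ι] [Nonempty ι] (u v : ι → R) :
    (1 + Matrix.vecMulVec u v).charpoly.roots =
      Multiset.replicate (Fintype.card ι - 1) 1 + {1 + u ⬝ᵥ v} := by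
  open Polynomial in
  have hfactor : (1 + Matrix.vecMulVec u v).charpoly =
      (X - C 1) ^ (Fintype.card ι - 1) * (X - C (1 + u ⬝ᵥ v)) := by
    have hsub : 1 + Matrix.vecMulVec u v = Matrix.vecMulVec u v - Matrix.scalar ι (-1) := by
      rw [map_neg, map_one, sub_neg_eq_add, add_comm]
    obtain ⟨n, hn⟩ := Nat.exists_eq_succ_of_ne_zero (Fintype.card_ne_zero (α := ι))
    rw [hsub, Matrix.charpoly_sub_scalar, Matrix.charpoly_vecMulVec, hn]
    simp only [Nat.succ_eq_add_one, add_tsub_cancel_right, smul_eq_C_mul, map_neg, map_one,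
      sub_comp, pow_comp, X_comp, mul_comp, C_comp, map_add]
    ring
  have hmonic := (Polynomial.monic_X_sub_C (1 : R)).pow (Fintype.card ι - 1)
  rw [hfactor, Polynomial.roots_mul (hmonic.mul (Polynomial.monic_X_sub_C _)).ne_zero,
    Polynomial.roots_pow, Polynomial.roots_X_sub_C, Polynomial.roots_X_sub_C,
    Multiset.nsmul_singleton]

theorem toLin'_one_add_smul_vecMulVec [DecidableEq ι] (γ : ℝ) (l v : ι → ℝ) :
    (Matrix.toLin' (1 + γ • Matrix.vecMulVec v l)).toContinuousLinearMap =
      .id ℝ (ι → ℝ) + (γ • dotFunctional l).smulRight v := by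
  ext1 x
  simp [Matrix.vecMulVec_mulVec, dotFunctional_apply, smul_smul]

theorem eq_zero_of_sum_negPart_div_eq_sum_neg_posPart_div (hy : y ∈ posVectors ι)
    (hsums : ∑ i, v⁻ i / y i = ∑ i, (-v⁺) i / y i) : v = 0 := by
  have habs : ∑ i, |v i| / y i = 0 := by
    rw [← sub_eq_zero, ← Finset.sum_sub_distrib] at hsums
    refine (Finset.sum_congr rfl fun i _ => ?_).trans hsums
    rw [← posPart_add_negPart, Pi.neg_apply, Pi.negPart_apply, Pi.posPart_apply]
    ring
  funext i
  have hi := (Finset.sum_eq_zero_iff_of_nonneg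
    fun j _ => div_nonneg (abs_nonneg (v j)) (hy j).le).1 habs i (Finset.mem_univ i)
  simpa [(hy i).ne'] using hi

namespace IsRankOneSystem

variable (hsys : IsRankOneSystem P S l v)
include hsys

theorem linearGeco2Map_eqOn_rankOneStep :
    Set.EqOn (linearGeco2Map P S Δt)
      (rankOneStep (dotFunctional l) v (geco2RankOneWeight l v Δt S.trace)) (posVectors ι) :=
  fun _ hy => hsys.linearGeco2Map_eq_rankOneStep fun i => (hy i).ne'

theorem linearGeco2Map_eventuallyEq_rankOneStep (hy : y ∈ posVectors ι) :
    linearGeco2Map P S Δt =ᶠ[𝓝 y]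
      rankOneStep (dotFunctional l) v (geco2RankOneWeight l v Δt S.trace) :=
  hsys.linearGeco2Map_eqOn_rankOneStep.eventuallyEq_of_mem ((isOpen_posVectors ι).mem_nhds hy)

theorem hasFDerivAt_linearGeco2Map (hy : y ∈ posVectors ι) (hly : l ⬝ᵥ y = 0) :
    HasFDerivAt (linearGeco2Map P S Δt)
      (.id ℝ (ι → ℝ) + (geco2Gain Δt S.trace • dotFunctional l).smulRight v) y := by
  rw [← geco2RankOneWeight_of_dotProduct_eq_zero (v := v) hly]
  exact (hasFDerivAt_rankOneStep (continuousAt_geco2RankOneWeight fun i => (hy i).ne') hly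
    ).congr_of_eventuallyEq (hsys.linearGeco2Map_eventuallyEq_rankOneStep hy)

theorem isStabilityFunctionAt_linearGeco2Map [DecidableEq ι] (hy : y ∈ posVectors ι)
    (hly : l ⬝ᵥ y = 0) :
    IsStabilityFunctionAt (geco2StabilityPolynomial (Δt * S.trace)) (linearGeco2Map P S Δt)
      (P - S) Δt y := by
  rw [IsStabilityFunctionAt, hsys.sub_eq,
    aeval_geco2StabilityPolynomial_vecMulVec hsys.dotProduct_eq, toLin'_one_add_smul_vecMulVec]
  exact hsys.hasFDerivAt_linearGeco2Map hy hly

theorem roots_charpoly_fderiv_linearGeco2Map [DecidableEq ι] [Nonempty ι] (hy : y ∈ posVectors ι)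
    (hly : l ⬝ᵥ y = 0) :
    (LinearMap.toMatrix' (fderiv ℝ (linearGeco2Map P S Δt) y : (ι → ℝ) →ₗ[ℝ] ι → ℝ)
      ).charpoly.roots = Multiset.replicate (Fintype.card ι - 1) 1 +
        {(geco2StabilityPolynomial (Δt * S.trace)).eval (-Δt * S.trace)} := by
  rw [(hsys.hasFDerivAt_linearGeco2Map hy hly).fderiv, ← toLin'_one_add_smul_vecMulVec,
    LinearMap.coe_toContinuousLinearMap, LinearMap.toMatrix'_toLin', ← Matrix.smul_vecMulVec,
    roots_charpoly_one_add_vecMulVec, smul_dotProduct, dotProduct_comm v, hsys.dotProduct_eq,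
    eval_geco2StabilityPolynomial, smul_eq_mul]

theorem exists_contDiffOn_one_linearGeco2Map (hy : y ∈ posVectors ι) :
    ∃ D ⊆ posVectors ι, IsOpen D ∧ y ∈ D ∧ ContDiffOn ℝ 1 (linearGeco2Map P S Δt) D ∧
      ∃ K : ℝ≥0, LipschitzOnWith K (fderiv ℝ (linearGeco2Map P S Δt)) D := by
  have hbranch (w : ι → ℝ) :
      ContDiffOn ℝ 2 (geco2BranchWeight l w Δt S.trace) (posVectors ι) := fun x hx =>
    (contDiffAt_geco2BranchWeight fun i => (hx i).ne').contDiffWithinAt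
  exact exists_contDiffOn_one_of_eqOn_rankOneStep (isOpen_posVectors ι) hy
    hsys.linearGeco2Map_eqOn_rankOneStep (fun x _ => geco2RankOneWeight_of_nonneg)
    (fun x _ => geco2RankOneWeight_of_nonpos) (hbranch v⁻) (hbranch (-v⁺))

theorem not_contDiffAt_two_linearGeco2Map (hΔt : Δt ≠ 0) (htr : S.trace ≠ 0)
    (hy : y ∈ posVectors ι) (hly : l ⬝ᵥ y = 0) :
    ¬ ContDiffAt ℝ 2 (linearGeco2Map P S Δt) y := by
  intro hC
  have hy0 (i : ι) : y i ≠ 0 := (hy i).ne'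
  have hlv : l ⬝ᵥ v ≠ 0 := hsys.dotProduct_eq ▸ neg_ne_zero.2 htr
  have hbranches := apply_eq_of_contDiffAt_two_of_eventuallyEq_rankOneStep hC
    (hsys.linearGeco2Map_eventuallyEq_rankOneStep hy) hly hlv
    (.of_forall fun x => geco2RankOneWeight_of_nonneg)
    (.of_forall fun x => geco2RankOneWeight_of_nonpos)
    (hasFDerivAt_geco2BranchWeight hy0 hly) (hasFDerivAt_geco2BranchWeight hy0 hly)
  have hsums : ∑ i, v⁻ i / y i = ∑ i, (-v⁺) i / y i := by
    have hgain := geco2Gain_ne_zero (s := S.trace) hΔt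
    have hdefect := (geco2Defect_pos (mul_ne_zero hΔt htr)).ne'
    simpa [dotFunctional_apply, hlv, hgain, hΔt, hdefect] using hbranches
  exact hlv (by rw [eq_zero_of_sum_negPart_div_eq_sum_neg_posPart_div hy hsums, dotProduct_zero])

end IsRankOneSystem

end RankOneSystem

theorem mainTheorem11_general {ι : Type*} [Fintype ι] [DecidableEq ι] {P S : Matrix ι ι ℝ}
    {l v : ι → ℝ} {Δt : ℝ} {ystar : ι → ℝ} (hsys : IsRankOneSystem P S l v) (hΔt : Δt ≠ 0)
    (htr : S.trace ≠ 0) (hpos : ystar ∈ posVectors ι) (hsteady : (P - S) *ᵥ ystar = 0) :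
    (∃ D ⊆ posVectors ι, IsOpen D ∧ ystar ∈ D ∧ ContDiffOn ℝ 1 (linearGeco2Map P S Δt) D ∧
      ∃ K : ℝ≥0, LipschitzOnWith K (fderiv ℝ (linearGeco2Map P S Δt)) D) ∧
    IsStabilityFunctionAt (geco2StabilityPolynomial (Δt * S.trace)) (linearGeco2Map P S Δt)
      (P - S) Δt ystar ∧
    (LinearMap.toMatrix' (fderiv ℝ (linearGeco2Map P S Δt) ystar : (ι → ℝ) →ₗ[ℝ] ι → ℝ)
      ).charpoly.roots = Multiset.replicate (Fintype.card ι - 1) 1 +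
        {(geco2StabilityPolynomial (Δt * S.trace)).eval (-Δt * S.trace)} ∧
    (|(geco2StabilityPolynomial (Δt * S.trace)).eval (-Δt * S.trace)| < 1 →
      IsLyapunovStable (linearGeco2Map P S Δt) (posVectors ι) ystar ∧
      ∃ δ > 0, ∀ y₀, y₀ - ystar ∈ Submodule.span ℝ {v} → ‖y₀ - ystar‖ < δ →
        Tendsto (fun n : ℕ => (linearGeco2Map P S Δt)^[n] y₀) atTop (𝓝 ystar)) ∧
    (1 < |(geco2StabilityPolynomial (Δt * S.trace)).eval (-Δt * S.trace)| →
      IsUnstable (linearGeco2Map P S Δt) (posVectors ι) ystar) ∧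
    ∀ U ∈ 𝓝 ystar, ¬ ContDiffOn ℝ 2 (linearGeco2Map P S Δt) U := by
  have hly := hsys.dotProduct_eq_zero_of_mulVec_eq_zero htr hsteady
  have hg := hsys.linearGeco2Map_eventuallyEq_rankOneStep (Δt := Δt) hpos
  have hω : ContinuousAt (geco2RankOneWeight l v Δt S.trace) ystar :=
    continuousAt_geco2RankOneWeight fun i => (hpos i).ne'
  have hrate : (geco2StabilityPolynomial (Δt * S.trace)).eval (-Δt * S.trace) =
      1 + geco2RankOneWeight l v Δt S.trace ystar * dotFunctional l v := by
    rw [eval_geco2StabilityPolynomial, geco2RankOneWeight_of_dotProduct_eq_zero hly,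
      dotFunctional_apply, hsys.dotProduct_eq]
  have : Nonempty ι := not_isEmpty_iff.1 fun _ => htr (Matrix.trace_eq_zero_of_isEmpty S)
  refine ⟨hsys.exists_contDiffOn_one_linearGeco2Map hpos,
    hsys.isStabilityFunctionAt_linearGeco2Map hpos hly,
    hsys.roots_charpoly_fderiv_linearGeco2Map hpos hly, fun hlt => ?_, fun hlt => ?_,
    fun U hU hC => hsys.not_contDiffAt_two_linearGeco2Map hΔt htr hpos hly (hC.contDiffAt hU)⟩
  · rw [hrate] at hlt
    refine ⟨isLyapunovStable_of_eventuallyEq_rankOneStep hg hω hly hlt, ?_⟩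
    simpa only [dist_eq_norm, imp.swap] using Metric.eventually_nhds_iff.1
      (eventually_tendsto_iterate_of_eventuallyEq_rankOneStep hg hω hly hlt)
  · rw [hrate] at hlt
    exact isUnstable_of_eventuallyEq_rankOneStep hg hω hly ((isOpen_posVectors ι).mem_nhds hpos) hlt

section TestSystem

variable {a b c : ℝ}

theorem trace_testSMinus : (testSMinus a b c).trace = a * c + b :=
  Matrix.trace_fin_two_of _ _ _ _

theorem trace_testSMinus_pos (ha : 0 ≤ a) (hb : 0 ≤ b) (hab : 0 < a + b) (hc : 0 < c) :
    0 < (testSMinus a b c).trace := by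
  rw [trace_testSMinus]
  rcases ha.eq_or_lt with rfl | ha
  · linarith
  · positivity

theorem isRankOneSystem_test :
    IsRankOneSystem (testSPlus a b c) (testSMinus a b c) ![-a, b] ![c, -1] where
  isDiag i j hij := by fin_cases i <;> fin_cases j <;> simp_all [testSMinus]
  trace_production := by simp [testSPlus, Matrix.trace_fin_two]
  sub_eq := by
    ext i j
    fin_cases i <;> fin_cases j <;> simp [testSPlus, testSMinus, mul_comm]

theorem sub_mem_span_of_dotProduct_eq {x y : Fin 2 → ℝ} (h : ![1, c] ⬝ᵥ x = ![1, c] ⬝ᵥ y) :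
    x - y ∈ Submodule.span ℝ {![c, -1]} := by
  have hcoord : x 0 + c * x 1 = y 0 + c * y 1 := by
    simpa [dotProduct, Fin.sum_univ_two] using h
  refine Submodule.mem_span_singleton.2 ⟨y 1 - x 1, funext <| Fin.forall_fin_two.2 ⟨?_, ?_⟩⟩
  · change (y 1 - x 1) * c = x 0 - y 0
    linear_combination -hcoord
  · change (y 1 - x 1) * -1 = x 1 - y 1
    ring

end TestSystem

theorem mainTheorem11 (a b c Δt : ℝ) (ha : 0 ≤ a) (hb : 0 ≤ b) (hab : 0 < a + b) (hc : 0 < c)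
    (hΔt : 0 < Δt) (ystar : Fin 2 → ℝ) (hpos : ystar ∈ posVectors (Fin 2))
    (hsteady : testLambda a b c *ᵥ ystar = 0) :
    -- `g` is `C¹` with Lipschitz continuous derivative on a neighborhood of the steady state
    (∃ D : Set (Fin 2 → ℝ), IsOpen D ∧ ystar ∈ D ∧ D ⊆ posVectors (Fin 2) ∧
      ContDiffOn ℝ 1 (geco2Map a b c Δt) D ∧
      ∃ K : ℝ≥0, LipschitzOnWith K (fderiv ℝ (geco2Map a b c Δt)) D) ∧
    -- the stability function, and the eigenvalues of the Jacobian with multiplicities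
    IsStabilityFunctionAt (geco2R a b c Δt) (geco2Map a b c Δt) (testLambda a b c) Δt ystar ∧
    (LinearMap.toMatrix' (fderiv ℝ (geco2Map a b c Δt) ystar : (Fin 2 → ℝ) →ₗ[ℝ] Fin 2 → ℝ)
      ).charpoly.roots = {1, (geco2R a b c Δt).eval (-Δt * (a * c + b))} ∧
    -- stability, and local convergence on the invariant line
    (|(geco2R a b c Δt).eval (-Δt * (a * c + b))| < 1 →
      IsLyapunovStable (geco2Map a b c Δt) (posVectors (Fin 2)) ystar ∧
      ∃ δ > 0, ∀ y₀ ∈ posVectors (Fin 2), ![1, c] ⬝ᵥ y₀ = ![1, c] ⬝ᵥ ystar → ‖y₀ - ystar‖ < δ →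
        Tendsto (fun n : ℕ => (geco2Map a b c Δt)^[n] y₀) atTop (𝓝 ystar)) ∧
    -- instability
    (1 < |(geco2R a b c Δt).eval (-Δt * (a * c + b))| →
      IsUnstable (geco2Map a b c Δt) (posVectors (Fin 2)) ystar) ∧
    -- `g` is not `C²` on any neighborhood of the steady state
    (∀ U ∈ 𝓝 ystar, ¬ ContDiffOn ℝ 2 (geco2Map a b c Δt) U) := by
  obtain ⟨⟨D, hDpos, hDopen, hyD, hC1⟩, hR, heigenvalues, hstable, hunstable, hC2⟩ :=
    mainTheorem11_general isRankOneSystem_test hΔt.ne'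
      (trace_testSMinus_pos ha hb hab hc).ne' hpos hsteady
  rw [← trace_testSMinus]
  refine ⟨⟨D, hDopen, hyD, hDpos, hC1⟩, hR, heigenvalues, fun hlt => ?_, hunstable, hC2⟩
  obtain ⟨hlyapunov, δ, hδ, hconv⟩ := hstable hlt
  exact ⟨hlyapunov, δ, hδ, fun y₀ _ hline => hconv y₀ (sub_mem_span_of_dotProduct_eq hline)⟩
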